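/- Let $d\ge 1$ be an integer and let $\sigma>0$, $p>0$, $0<\varepsilon\le 1$ be real numbers. Let $B_2^d\subseteq\mathbb R^d$ be the closed Euclidean unit ball, let $H_\sigma(B_2^d)$ be the real reproducing kernel Hilbert space on $B_2^d$ with the Gaussian kernel $k_\sigma(x,x')=\exp(-\sigma^2\|x-x'\|_2^2)$, and let $\mathrm{Id}:H_\sigma(B_2^d)\to\ell_\infty(B_2^d)$ be the canonical embedding into the space of bounded real functions on $B_2^d$ with the supremum norm. For a bounded linear operator $T:E\to F$ between Banach spaces, let $\mathcal H(\varepsilon,T)=\log\mathcal N(\varepsilon,T)$, where $\mathcal N(\varepsilon,T)$ is the least number of closed balls of radius $\varepsilon$ with centres in $F$ that cover the image under $T$ of the closed unit ball of $E$. Let $W_0:[-1/e,\infty)\to[-1,\infty)$ be the upper branch of Lambert's function, that is, the inverse of $w\mapsto we^w$ on $[-1,\infty)$, and write $\binom{t+d}{d}=\frac1{d!}\prod_{i=1}^d(t+i)$ for real $t>0$. With $$t_0=\frac{2(d+1)\,4^{\frac{p}{d+1}}}{e\,p\,W_0\!\left(\frac{d+1}{p\sigma^2}\right)}\exp\!\left(\frac{1}{W_0\!\left(\frac{d+1}{p\sigma^2}\right)}\right)$$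 we have $$\mathcal H\bigl(\varepsilon,\ \mathrm{Id}:H_\sigma(B_2^d)\to\ell_\infty(B_2^d)\bigr)\le\binom{t_0+d}{d}\cdot\frac{d+1}{e\,p}\cdot 4^{\frac{p}{d+1}}\cdot\varepsilon^{-p}.$$ -/

import Mathlib

open scoped ENNReal NNReal

/-- The isotropic Gaussian kernel `exp (-σ² ‖x - y‖²)` on `ℝᵈ` with the Euclidean norm. -/
noncomputable def gaussianKernel {d : ℕ} (σ : ℝ) (x y : EuclideanSpace ℝ (Fin d)) : ℝ :=
  Real.exp (-σ ^ 2 * ‖x - y‖ ^ 2)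

/-- The Gaussian kernel restricted to `X ⊆ ℝᵈ`, in the operator-valued format used by `RKHS`:
the entry at `(x, y)` is multiplication by `gaussianKernel σ x y` on `ℝ`. -/
noncomputable def gaussianKernelMatrix {d : ℕ} (X : Set (EuclideanSpace ℝ (Fin d))) (σ : ℝ) :
    Matrix X X (ℝ →L[ℝ] ℝ) :=
  Matrix.of fun x y ↦
    gaussianKernel σ (x : EuclideanSpace ℝ (Fin d)) (y : EuclideanSpace ℝ (Fin d)) •
      ContinuousLinearMap.id ℝ ℝ

theorem gaussianKernel_eq_integral {d : ℕ} (σ : ℝ) (x y : EuclideanSpace ℝ (Fin d)) :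
    gaussianKernel σ x y =
      ∫ z, Real.cos (inner ℝ z ((√2 * σ) • (x - y)))
        ∂(ProbabilityTheory.stdGaussian (EuclideanSpace ℝ (Fin d))) := by
  have h := ProbabilityTheory.charFun_stdGaussian (E := EuclideanSpace ℝ (Fin d))
    ((√2 * σ) • (x - y))
  have h2 := congrArg Complex.re h
  rw [MeasureTheory.charFun_apply] at h2
  have h3 := integral_re (𝕜 := ℂ)
    (μ := ProbabilityTheory.stdGaussian (EuclideanSpace ℝ (Fin d)))
    (f := fun z ↦ Complex.exp ((inner ℝ z ((√2 * σ) • (x - y)) : ℝ) * Complex.I)) (by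
      refine (MeasureTheory.integrable_const (1 : ℝ)).mono' (by fun_prop) ?_
      filter_upwards with z
      simp [Complex.norm_exp_ofReal_mul_I])
  simp only [RCLike.re_eq_complex_re, Complex.exp_ofReal_mul_I_re] at h3
  have h4 : ((-(‖(√2 * σ) • (x - y)‖ : ℂ) ^ 2 / 2) : ℂ) =
      ((-σ ^ 2 * ‖x - y‖ ^ 2 : ℝ) : ℂ) := by
    have h5 : ‖(√2 * σ) • (x - y)‖ ^ 2 = 2 * σ ^ 2 * ‖x - y‖ ^ 2 := by
      rw [norm_smul, mul_pow, Real.norm_eq_abs, sq_abs, mul_pow, Real.sq_sqrt (by norm_num)]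
    rw [← Complex.ofReal_pow, h5]
    push_cast
    ring
  rw [h3, h2, h4, ← Complex.ofReal_exp, Complex.ofReal_re, gaussianKernel]

/-- The Gaussian kernel is positive semidefinite. -/
theorem gaussianKernelMatrix_posSemidef {d : ℕ} (X : Set (EuclideanSpace ℝ (Fin d))) (σ : ℝ) :
    (gaussianKernelMatrix X σ).PosSemidef := by
  have h := (RKHS.posSemidef_tfae (K := gaussianKernelMatrix X σ)).out 0 2
  refine h.2 ⟨?_, fun v ↦ ?_⟩
  · ext x y
    simp [gaussianKernelMatrix, gaussianKernel, ContinuousLinearMap.star_eq_adjoint,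
      norm_sub_rev (y : EuclideanSpace ℝ (Fin d)) x, ContinuousLinearMap.adjoint_id]
  · set μ := ProbabilityTheory.stdGaussian (EuclideanSpace ℝ (Fin d))
    let a : EuclideanSpace ℝ (Fin d) → X → ℝ := fun z x ↦
      inner ℝ z ((√2 * σ) • (x : EuclideanSpace ℝ (Fin d)))
    have key : (v.sum fun x w ↦ v.sum fun x' w' ↦
        inner ℝ (gaussianKernelMatrix X σ x' x w) w') =
        ∫ z, ((∑ x ∈ v.support, v x * Real.cos (a z x)) ^ 2 +
          (∑ x ∈ v.support, v x * Real.sin (a z x)) ^ 2) ∂μ := by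
      have hint : ∀ x x' : X, MeasureTheory.Integrable (fun z ↦
          Real.cos (inner ℝ z ((√2 * σ) • ((x' : EuclideanSpace ℝ (Fin d)) - x))) * (v x * v x'))
          μ := by
        intro x x'
        refine (MeasureTheory.Integrable.mul_const ?_ _)
        refine (MeasureTheory.integrable_const (1 : ℝ)).mono' (by fun_prop) ?_
        filter_upwards with z
        exact Real.abs_cos_le_one _
      simp only [Finsupp.sum]
      calc _ = ∑ x ∈ v.support, ∑ x' ∈ v.support, ∫ z,
            Real.cos (inner ℝ z ((√2 * σ) • ((x' : EuclideanSpace ℝ (Fin d)) - x))) * (v x * v x')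
              ∂μ := by
            refine Finset.sum_congr rfl fun x _ ↦ Finset.sum_congr rfl fun x' _ ↦ ?_
            rw [MeasureTheory.integral_mul_const, ← gaussianKernel_eq_integral]
            simp [gaussianKernelMatrix]
            ring
        _ = ∫ z, ∑ x ∈ v.support, ∑ x' ∈ v.support,
            Real.cos (inner ℝ z ((√2 * σ) • ((x' : EuclideanSpace ℝ (Fin d)) - x))) * (v x * v x')
              ∂μ := by
            rw [MeasureTheory.integral_finsetSum _ fun x _ ↦
              MeasureTheory.integrable_finsetSum _ fun x' _ ↦ hint x x']
            refine Finset.sum_congr rfl fun x _ ↦ ?_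
            rw [MeasureTheory.integral_finsetSum _ fun x' _ ↦ hint x x']
        _ = _ := by
            congr 1
            ext z
            rw [sq, sq, Finset.sum_mul_sum, Finset.sum_mul_sum, ← Finset.sum_add_distrib]
            refine Finset.sum_congr rfl fun x _ ↦ ?_
            rw [← Finset.sum_add_distrib]
            refine Finset.sum_congr rfl fun x' _ ↦ ?_
            rw [smul_sub, inner_sub_right, Real.cos_sub]
            simp only [a]
            ring
    rw [key]
    exact MeasureTheory.integral_nonneg fun z ↦ by positivity

instance gaussianKernelMatrix_fact {d : ℕ} (X : Set (EuclideanSpace ℝ (Fin d))) (σ : ℝ) :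
    Fact (gaussianKernelMatrix X σ).PosSemidef :=
  ⟨gaussianKernelMatrix_posSemidef X σ⟩

/-- The Gaussian reproducing kernel Hilbert space `H_σ(X)`: the real Hilbert space of functions
on `X` with reproducing kernel `gaussianKernel σ`. -/
abbrev GaussianRKHS {d : ℕ} (X : Set (EuclideanSpace ℝ (Fin d))) (σ : ℝ) : Type :=
  RKHS.OfKernel (gaussianKernelMatrix X σ)

theorem GaussianRKHS.norm_apply_le {d : ℕ} {X : Set (EuclideanSpace ℝ (Fin d))} {σ : ℝ}
    (f : GaussianRKHS X σ) (x : X) : ‖f x‖ ≤ ‖f‖ := by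
  refine (RKHS.norm_apply_le f x).trans ?_
  rw [RKHS.OfKernel.kernel_ofKernel]
  simp [gaussianKernelMatrix, gaussianKernel]

/-- The canonical embedding `Id : H_σ(X) → ℓ_∞(X)`, `f ↦ (f(x))_{x ∈ X}`, as a bounded linear
operator. Here `lp (fun _ : X ↦ ℝ) ∞` is the space of bounded functions `X → ℝ` with the
supremum norm. -/
noncomputable def gaussianEmbedding {d : ℕ} (X : Set (EuclideanSpace ℝ (Fin d))) (σ : ℝ) :
    GaussianRKHS X σ →L[ℝ] lp (fun _ : X ↦ ℝ) ∞ :=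
  LinearMap.mkContinuous
    { toFun := fun f ↦ ⟨fun x ↦ f x, memℓp_infty ⟨‖f‖, by
        rintro _ ⟨x, rfl⟩
        exact GaussianRKHS.norm_apply_le f x⟩⟩
      map_add' := fun f g ↦ by ext x; exact congrFun (RKHS.coe_add f g) x
      map_smul' := fun c f ↦ by ext x; exact congrFun (RKHS.coe_smul f c) x }
    1 fun f ↦ by
      rw [one_mul]
      exact lp.norm_le_of_forall_le (norm_nonneg f) fun x ↦ GaussianRKHS.norm_apply_le f x

/-- The log-covering number of a bounded operator `T : E → F` at scale `ε`: the natural logarithm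
of the least number of closed `ε`-balls with centres in `F` that cover `T '' B_E`, where `B_E` is
the closed unit ball of `E`. It is `⊤` if no finite number of balls suffices. -/
noncomputable def logCoveringNumber {E F : Type*} [NormedAddCommGroup E] [NormedSpace ℝ E]
    [NormedAddCommGroup F] [NormedSpace ℝ F] (ε : ℝ) (T : E →L[ℝ] F) : EReal :=
  ENNReal.log
    ((Metric.externalCoveringNumber ε.toNNReal (T '' Metric.closedBall (0 : E) 1) : ℕ∞) : ℝ≥0∞)

/-- The generalized binomial coefficient `t(t-1)⋯(t-k+1) / k!` for real `t`, written as
`(∏_{i=1}^k (t - k + i)) / k!`. -/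
noncomputable def genBinom (t : ℝ) (k : ℕ) : ℝ :=
  (∏ i ∈ Finset.Icc 1 k, (t - (k : ℝ) + (i : ℝ))) / (k.factorial : ℝ)

/-- The upper branch `W₀ : [-1/e, ∞) → [-1, ∞)` of Lambert's function: the inverse of
`w ↦ w * exp w` on `[-1, ∞)`. Its values outside `[-1/e, ∞)` are irrelevant. -/
noncomputable def lambertW₀ : ℝ → ℝ :=
  Function.invFunOn (fun w : ℝ ↦ w * Real.exp w) (Set.Ici (-1))

/-- The quantity `t₀`, for dimension `d`, kernel width `σ` and exponent `p`. -/
noncomputable def polyT₀ (d : ℕ) (σ p : ℝ) : ℝ :=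
  2 * ((d : ℝ) + 1) * (4 : ℝ) ^ (p / ((d : ℝ) + 1)) /
      (Real.exp 1 * p * lambertW₀ (((d : ℝ) + 1) / (p * σ ^ 2))) *
    Real.exp (1 / lambertW₀ (((d : ℝ) + 1) / (p * σ ^ 2)))

/-! Expanding `exp (2σ²⟨x, y⟩)` by the multinomial theorem gives an explicit `ℓ²` feature map for
the Gaussian kernel. On the unit ball, the squared coordinates of degree `n` add up to the Poisson
weight `exp (-u) u ^ n / n!` with `u = 2σ²‖x‖² ≤ 2σ²`. Cutting at degree `M` leaves `(M + d).choose
d` coordinates and a Poisson tail, which the Chernoff bound controls (`one_sub_sum_exp_neg_mul_le`).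
A volumetric net of the remaining Euclidean ball then covers the image
(`logCoveringNumber_gaussianEmbedding_le`), so the entropy is at most `(M + d).choose d * log (4 /
ε)`.

What remains is to choose `M`. The tail is small enough once `S log (S / (e σ²)) ≥ log (4 / ε)` and
`M + 1 ≥ 2S`. With `q = p / (d + 1)`, Lambert's function supplies such an `S` with `2S = t₀ ε ^
(-q)` (`le_mul_log_of_mul_exp_eq`, `polyT₀_mul_rpow`). The binomial coefficient then contributes `d`
factors `ε ^ (-q)` and the bound on `log (4 / ε)` one more, in total `ε ^ (-p)`. -/

/-! ### Lambert's function and the truncation level -/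

theorem lambertW₀_mul_exp {y : ℝ} (hy : 0 ≤ y) : lambertW₀ y * Real.exp (lambertW₀ y) = y := by
  have hcont : ContinuousOn (fun w : ℝ ↦ w * Real.exp w) (Set.Icc 0 y) := by fun_prop
  have hmem : y ∈ Set.Icc ((0 : ℝ) * Real.exp 0) (y * Real.exp y) :=
    ⟨by simpa using hy, le_mul_of_one_le_right hy (Real.one_le_exp hy)⟩
  obtain ⟨w, hw, hwy⟩ := intermediate_value_Icc hy hcont hmem
  exact Function.invFunOn_eq (f := fun w : ℝ ↦ w * Real.exp w) (s := Set.Ici (-1)) (b := y)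
    ⟨w, by simp only [Set.mem_Ici]; linarith [hw.1], hwy⟩

theorem lambertW₀_pos {y : ℝ} (hy : 0 < y) : 0 < lambertW₀ y := by
  have h := lambertW₀_mul_exp hy.le
  exact pos_of_mul_pos_left (h.symm ▸ hy) (Real.exp_pos _).le

/-- If `w eʷ = 1 / (q s)` and `S = exp (q L + 1 / w) / (e q w)`, then `S` lies beyond the point
where `S log (S / (e s))` reaches `L`. -/
theorem le_mul_log_of_mul_exp_eq {q s w L : ℝ} (hq : 0 < q) (hs : 0 < s) (hw : 0 < w)
    (hweq : w * Real.exp w = 1 / (q * s)) (hL : 0 ≤ L) :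
    0 ≤ Real.log (Real.exp (q * L + 1 / w) / (Real.exp 1 * q * w) / (Real.exp 1 * s)) ∧
    L ≤ Real.exp (q * L + 1 / w) / (Real.exp 1 * q * w) *
      Real.log (Real.exp (q * L + 1 / w) / (Real.exp 1 * q * w) / (Real.exp 1 * s)) := by
  -- The equation for `w` turns `1 / (q s w)` into `exp w`, and `1 / w + w - 2 = (w - 1)² / w`.
  have harg : Real.exp (q * L + 1 / w) / (Real.exp 1 * q * w) / (Real.exp 1 * s) =
      Real.exp (q * L + (w - 1) ^ 2 / w) := by
    have h1 : Real.exp (q * L + (w - 1) ^ 2 / w) =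
        Real.exp (q * L + 1 / w) * Real.exp w / (Real.exp 1 * Real.exp 1) := by
      rw [← Real.exp_add, ← Real.exp_add, ← Real.exp_sub]
      congr 1
      field_simp
      ring
    have h2 : Real.exp w = 1 / (q * s) / w := by
      rw [← hweq]; field_simp
    rw [h1, h2]
    field_simp
  have hx : 0 ≤ q * L := by positivity
  rw [harg, Real.log_exp]
  refine ⟨by positivity, ?_⟩
  have hexp : Real.exp 1 * (q * L + 1 / w) ≤ Real.exp (q * L + 1 / w) := by
    have h := Real.add_one_le_exp (q * L + 1 / w - 1)
    rw [Real.exp_sub, le_div_iff₀ (Real.exp_pos 1)] at h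
    linarith
  calc L ≤ (q * L + 1 / w) / (q * w) * (q * L + (w - 1) ^ 2 / w) := by
        rw [div_mul_eq_mul_div, le_div_iff₀ (by positivity), ← sub_nonneg]
        -- The inequality reduces to the nonnegativity of a perfect square.
        have : (q * L + 1 / w) * (q * L + (w - 1) ^ 2 / w) - L * (q * w) =
            (w * (q * L) - (w - 1)) ^ 2 / w ^ 2 := by
          field_simp
          ring
        rw [this]
        positivity
    _ ≤ _ := by
        refine mul_le_mul_of_nonneg_right ?_ (by positivity)
        rw [div_le_div_iff₀ (by positivity) (by positivity)]
        calc _ = Real.exp 1 * (q * L + 1 / w) * (q * w) := by ring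
          _ ≤ _ := mul_le_mul_of_nonneg_right hexp (by positivity)

/-! ### Poisson tails -/

theorem hasSum_real_exp (x : ℝ) : HasSum (fun n : ℕ ↦ x ^ n / n.factorial) (Real.exp x) := by
  simpa [Real.exp_eq_exp_ℝ] using NormedSpace.expSeries_div_hasSum_exp (𝔸 := ℝ) x

/-- Chernoff bound for the upper tail of the Poisson distribution of rate `u ≤ l`. -/
theorem one_sub_sum_exp_neg_mul_le {u l : ℝ} (hu : 0 ≤ u) (hul : u ≤ l) {N : ℕ} (hN : 0 < N)
    (hlN : l ≤ N) :
    1 - ∑ n ∈ Finset.range N, Real.exp (-u) * (u ^ n / n.factorial) ≤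
      (Real.exp 1 * l / N) ^ N := by
  have hl : 0 ≤ l := hu.trans hul
  have hN' : (0 : ℝ) < N := by exact_mod_cast hN
  have htail := (hasSum_nat_add_iff' N).2 (hasSum_real_exp u)
  have htail' := ((hasSum_nat_add_iff' N).2 (hasSum_real_exp N)).mul_left ((l / N) ^ N)
  -- Termwise comparison with the exponential series at `N`: since `l / N ≤ 1`, each tail term loses
  -- at least the factor `(l / N) ^ N`.
  have hle : Real.exp u - ∑ n ∈ Finset.range N, u ^ n / n.factorial ≤
      (l / N) ^ N * (Real.exp N - ∑ n ∈ Finset.range N, (N : ℝ) ^ n / n.factorial) := by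
    refine hasSum_le (fun n ↦ ?_) htail htail'
    rw [mul_div_assoc']
    refine div_le_div_of_nonneg_right ?_ (by positivity)
    calc u ^ (n + N) ≤ l ^ (n + N) := pow_le_pow_left₀ hu hul _
      _ = (l / N) ^ (n + N) * (N : ℝ) ^ (n + N) := by rw [← mul_pow]; field_simp
      _ ≤ (l / N) ^ N * (N : ℝ) ^ (n + N) := by
        refine mul_le_mul_of_nonneg_right ?_ (by positivity)
        exact pow_le_pow_of_le_one (by positivity) ((div_le_one hN').2 hlN) (by omega)
  have hle2 : Real.exp u - ∑ n ∈ Finset.range N, u ^ n / n.factorial ≤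
      (Real.exp 1 * l / N) ^ N := by
    refine hle.trans ?_
    rw [mul_div_assoc, mul_pow, ← Real.exp_nat_mul, mul_one, mul_comm]
    refine mul_le_mul_of_nonneg_right ?_ (by positivity)
    have : 0 ≤ ∑ n ∈ Finset.range N, (N : ℝ) ^ n / n.factorial := by positivity
    linarith
  rw [← Finset.mul_sum]
  calc _ = Real.exp (-u) * (Real.exp u - ∑ n ∈ Finset.range N, u ^ n / n.factorial) := by
        rw [mul_sub, ← Real.exp_add]; simp
    _ ≤ Real.exp (-u) * (Real.exp 1 * l / N) ^ N :=
        mul_le_mul_of_nonneg_left hle2 (Real.exp_pos _).le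
    _ ≤ _ := mul_le_of_le_one_left (by positivity) (Real.exp_le_one_iff.2 (by linarith))

/-- Both `N` and `log (N / (e l))` increase with `N`, so the Chernoff exponent at `N` dominates the
one at the real threshold `T`; the sign condition on the logarithm allows multiplying the two
inequalities. -/
theorem pow_le_exp_neg_of_le_mul_log {l T c : ℝ} (hl : 0 < l) (hT : 0 < T) {N : ℕ}
    (hTN : T ≤ N) (hlog : 0 ≤ Real.log (T / (Real.exp 1 * l)))
    (hc : c ≤ T * Real.log (T / (Real.exp 1 * l))) :
    (Real.exp 1 * l / N) ^ N ≤ Real.exp (-c) := by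
  have hN : (0 : ℝ) < N := hT.trans_le hTN
  have h1 : Real.log (T / (Real.exp 1 * l)) ≤ Real.log (N / (Real.exp 1 * l)) :=
    Real.log_le_log (by positivity) (by gcongr)
  have h2 : c ≤ N * Real.log (N / (Real.exp 1 * l)) :=
    hc.trans (mul_le_mul hTN h1 hlog hN.le)
  rw [← Real.exp_log (show (0 : ℝ) < (Real.exp 1 * l / N) ^ N by positivity), Real.exp_le_exp,
    Real.log_pow, ← inv_div, Real.log_inv]
  linarith

/-! ### Generalized binomial coefficients and a logarithm bound -/

theorem genBinom_add_eq (t : ℝ) (d : ℕ) :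
    genBinom (t + d) d = (∏ i ∈ Finset.Icc 1 d, (t + (i : ℝ))) / (d.factorial : ℝ) := by
  simp [genBinom]

theorem prod_Icc_cast_add (M d : ℕ) :
    ∏ i ∈ Finset.Icc 1 d, ((M : ℝ) + (i : ℝ)) = ((M + 1).ascFactorial d : ℕ) := by
  induction d with
  | zero => simp
  | succ d ih =>
    rw [Finset.prod_Icc_succ_top (by omega), ih, Nat.ascFactorial_succ]
    push_cast
    ring

theorem choose_le_genBinom {M d : ℕ} {t : ℝ} (h : (M : ℝ) ≤ t) :
    ((M + d).choose d : ℝ) ≤ genBinom (t + d) d := by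
  rw [genBinom_add_eq, le_div_iff₀ (by positivity)]
  calc ((M + d).choose d : ℝ) * d.factorial
      = ∏ i ∈ Finset.Icc 1 d, ((M : ℝ) + (i : ℝ)) := by
        rw [prod_Icc_cast_add, Nat.ascFactorial_eq_factorial_mul_choose]
        push_cast
        ring
    _ ≤ _ := by gcongr

/-- Each factor satisfies `t r + i ≤ r (t + i)`. This separates the dependence on `ε` from `t₀`. -/
theorem genBinom_mul_le {t r : ℝ} (ht : 0 ≤ t) (hr : 1 ≤ r) (d : ℕ) :
    genBinom (t * r + d) d ≤ r ^ d * genBinom (t + d) d := by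
  rw [genBinom_add_eq, genBinom_add_eq, mul_div_assoc']
  refine div_le_div_of_nonneg_right ?_ (by positivity)
  have hr0 : 0 ≤ r := by linarith
  calc ∏ i ∈ Finset.Icc 1 d, (t * r + (i : ℝ))
      ≤ ∏ i ∈ Finset.Icc 1 d, (r * (t + (i : ℝ))) := by
        refine Finset.prod_le_prod (fun i _ ↦ by positivity) fun i _ ↦ ?_
        nlinarith [mul_nonneg (Nat.cast_nonneg (α := ℝ) i) (sub_nonneg.2 hr)]
    _ = _ := by rw [Finset.prod_mul_distrib]; simp

theorem genBinom_add_nonneg {t : ℝ} (ht : 0 ≤ t) (d : ℕ) : 0 ≤ genBinom (t + d) d := by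
  rw [genBinom_add_eq]
  positivity

theorem log_le_rpow_div_exp_one_mul {x q : ℝ} (hx : 0 < x) (hq : 0 < q) :
    Real.log x ≤ x ^ q / (Real.exp 1 * q) := by
  rw [le_div_iff₀ (by positivity), Real.rpow_def_of_pos hx]
  have h := Real.add_one_le_exp (Real.log x * q - 1)
  rw [Real.exp_sub, le_div_iff₀ (Real.exp_pos 1)] at h
  linarith

/-! ### Nets of finite-dimensional unit balls -/

open MeasureTheory Metric Module in
/-- The volume bound for a separated subset of the unit ball. -/
theorem card_le_of_separated_unit_ball {E : Type*} [NormedAddCommGroup E] [NormedSpace ℝ E]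
    [FiniteDimensional ℝ E] {δ : ℝ} (hδ : 0 < δ) (s : Finset E) (hs : ∀ c ∈ s, ‖c‖ ≤ 1)
    (h : ∀ c ∈ s, ∀ d ∈ s, c ≠ d → δ ≤ dist c d) :
    (s.card : ℝ) ≤ (1 + 2 / δ) ^ finrank ℝ E := by
  borelize E
  let μ : Measure E := Measure.addHaar
  have hδ2 : 0 < δ / 2 := by positivity
  have hρ : 0 < 1 + δ / 2 := by positivity
  have hdisj : Set.PairwiseDisjoint (s : Set E) fun c ↦ ball c (δ / 2) := by
    intro c hc d hd hcd
    exact ball_disjoint_ball (by linarith [h c hc d hd hcd])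
  have hsub : ⋃ c ∈ s, ball c (δ / 2) ⊆ ball (0 : E) (1 + δ / 2) := by
    refine Set.iUnion₂_subset fun x hx ↦ ball_subset_ball' ?_
    rw [dist_zero_right]
    linarith [hs x hx]
  have hI : (s.card : ℝ≥0∞) * ENNReal.ofReal ((δ / 2) ^ finrank ℝ E) * μ (ball 0 1) ≤
      ENNReal.ofReal ((1 + δ / 2) ^ finrank ℝ E) * μ (ball 0 1) :=
    calc _ = μ (⋃ c ∈ s, ball c (δ / 2)) := by
          rw [measure_biUnion_finset hdisj fun c _ ↦ measurableSet_ball]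
          simp only [μ.addHaar_ball_of_pos _ hδ2]
          simp only [Finset.sum_const, nsmul_eq_mul, mul_assoc]
      _ ≤ μ (ball (0 : E) (1 + δ / 2)) := measure_mono hsub
      _ = _ := by simp only [μ.addHaar_ball_of_pos _ hρ]
  have hJ := (ENNReal.mul_le_mul_iff_left (measure_ball_pos μ (0 : E) zero_lt_one).ne'
    measure_ball_lt_top.ne).1 hI
  have hK := ENNReal.toReal_le_of_le_ofReal (by positivity) hJ
  rw [ENNReal.toReal_mul, ENNReal.toReal_natCast, ENNReal.toReal_ofReal (by positivity),
    ← le_div_iff₀ (by positivity), ← div_pow] at hK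
  have hratio : (1 + δ / 2) / (δ / 2) = 1 + 2 / δ := by
    field_simp
    ring
  rwa [hratio] at hK

-- A maximal `δ`-separated subset of the ball is a `δ`-net, and the volume bound controls its size.
open Metric Module in
theorem exists_finset_cover_unit_ball {E : Type*} [NormedAddCommGroup E] [NormedSpace ℝ E]
    [FiniteDimensional ℝ E] {δ : ℝ} (hδ : 0 < δ) :
    ∃ s : Finset E, (s.card : ℝ) ≤ (1 + 2 / δ) ^ finrank ℝ E ∧ (∀ c ∈ s, ‖c‖ ≤ 1) ∧
      ∀ v : E, ‖v‖ ≤ 1 → ∃ c ∈ s, dist v c ≤ δ := by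
  set B := closedBall (0 : E) 1
  set δ' : ℝ≥0 := ⟨δ, hδ.le⟩
  have hfin (s : Finset E) (hsB : (s : Set E) ⊆ B) (hsep : IsSeparated (δ' : ℝ≥0∞) (s : Set E)) :
      (s.card : ℝ) ≤ (1 + 2 / δ) ^ finrank ℝ E := by
    refine card_le_of_separated_unit_ball hδ s (fun c hc ↦ by simpa [B] using hsB hc) ?_
    intro c hc d hd hcd
    have h : (δ' : ℝ≥0∞) < edist c d := hsep hc hd hcd
    rw [edist_nndist, ENNReal.coe_lt_coe] at h
    exact (NNReal.coe_lt_coe.2 h).le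
  have hpack : packingNumber δ' B ≤ ⌊(1 + 2 / δ) ^ finrank ℝ E⌋₊ := by
    simp only [packingNumber, iSup_le_iff]
    intro C hCB hC
    have hle (t : Finset E) (ht : (t : Set E) ⊆ C) :
        t.card ≤ ⌊(1 + 2 / δ) ^ finrank ℝ E⌋₊ :=
      Nat.le_floor (hfin t (ht.trans hCB) (hC.mono ht))
    have hCfin : C.Finite := by
      by_contra hinf
      obtain ⟨t, ht, hcard⟩ := Set.Infinite.exists_subset_card_eq hinf
        (⌊(1 + 2 / δ) ^ finrank ℝ E⌋₊ + 1)
      have := hle t ht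
      omega
    lift C to Finset E using hCfin
    rw [Set.encard_coe_eq_coe_finsetCard]
    exact_mod_cast hle C subset_rfl
  have hne : packingNumber δ' B ≠ ⊤ := ne_top_of_le_ne_top (ENat.natCast_ne_top _) hpack
  have hM := isCover_maximalSeparatedSet hne
  have hMB : maximalSeparatedSet δ' B ⊆ B := maximalSeparatedSet_subset
  have hMfin : (maximalSeparatedSet δ' B).Finite := by
    rw [← Set.encard_ne_top_iff, encard_maximalSeparatedSet hne]
    exact hne
  refine ⟨hMfin.toFinset, hfin _ (by simpa using hMB)
    (by simpa using isSeparated_maximalSeparatedSet), fun c hc ↦ ?_, fun v hv ↦ ?_⟩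
  · simpa [B] using hMB (hMfin.mem_toFinset.1 hc)
  · obtain ⟨c, hc, hvc⟩ := hM (show v ∈ B by simpa [B] using hv)
    refine ⟨c, hMfin.mem_toFinset.2 hc, ?_⟩
    simp only [edist_nndist, Set.mem_ofPred_eq, ENNReal.coe_le_coe] at hvc
    exact NNReal.coe_le_coe.2 hvc

/-! ### From feature maps to covering numbers -/

theorem norm_finsuppSum_smul_eq {ι E F : Type*} [NormedAddCommGroup E] [InnerProductSpace ℝ E]
    [NormedAddCommGroup F] [InnerProductSpace ℝ F] {a : ι → E} {b : ι → F}
    (h : ∀ i j, inner ℝ (a i) (a j) = inner ℝ (b i) (b j)) (c : ι →₀ ℝ) :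
    ‖c.sum fun i r ↦ r • a i‖ = ‖c.sum fun i r ↦ r • b i‖ := by
  rw [← sq_eq_sq₀ (norm_nonneg _) (norm_nonneg _), ← real_inner_self_eq_norm_sq,
    ← real_inner_self_eq_norm_sq]
  simp only [Finsupp.sum, sum_inner, inner_sum, real_inner_smul_left, real_inner_smul_right, h]

/-- Elements of the span of the kernel functions are represented, with the same norm, by vectors
of any feature space. -/
theorem RKHS.exists_feature_of_mem_span {X H G : Type*} [NormedAddCommGroup H]
    [InnerProductSpace ℝ H] [CompleteSpace H] [RKHS ℝ H X ℝ] [NormedAddCommGroup G]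
    [InnerProductSpace ℝ G] {φ : X → G}
    (hφ : ∀ x y, RKHS.kernel H x y 1 = inner ℝ (φ x) (φ y)) {f : H}
    (hf : f ∈ Submodule.span ℝ {RKHS.kerFun H x v | (x) (v)}) :
    ∃ w : G, ‖w‖ = ‖f‖ ∧ ∀ x, f x = inner ℝ w (φ x) := by
  have hle : Submodule.span ℝ {RKHS.kerFun H x v | (x) (v)} ≤
      Submodule.span ℝ (Set.range fun x ↦ RKHS.kerFun H x 1) := by
    rw [Submodule.span_le]
    rintro _ ⟨x, v, rfl⟩
    have : RKHS.kerFun H x v = v • RKHS.kerFun H x 1 := by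
      rw [← map_smul, smul_eq_mul, mul_one]
    rw [this]
    exact Submodule.smul_mem _ _ (Submodule.subset_span ⟨x, rfl⟩)
  obtain ⟨c, rfl⟩ := Finsupp.mem_span_range_iff_exists_finsupp.1 (hle hf)
  have hinner (x y : X) : inner ℝ (RKHS.kerFun H x 1) (RKHS.kerFun H y 1) =
      inner ℝ (φ x) (φ y) := by
    rw [← RKHS.kernel_inner, hφ, real_inner_comm (φ x)]
    simp
  refine ⟨c.sum fun x r ↦ r • φ x, norm_finsuppSum_smul_eq (fun x y ↦ (hinner x y).symm) c,
    fun x ↦ ?_⟩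
  have heval (g : H) : g x = inner ℝ g (RKHS.kerFun H x 1) := by simp
  rw [heval]
  simp only [Finsupp.sum, sum_inner, real_inner_smul_left, hinner]

/-- Cauchy–Schwarz against the part of `u` outside `A`, whose squared norm is `‖u‖²` minus the part
inside. -/
theorem lp.abs_inner_sub_sum_le {I : Type*} (w u : lp (fun _ : I ↦ ℝ) 2) (A : Finset I) {τ : ℝ}
    (hτ : 0 ≤ τ) (hA : ‖u‖ ^ 2 - ∑ i ∈ A, u i ^ 2 ≤ τ ^ 2) :
    |inner ℝ w u - ∑ i ∈ A, w i * u i| ≤ ‖w‖ * τ := by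
  classical
  have hinner : inner ℝ w u - ∑ i ∈ A, w i * u i =
      inner ℝ w (u - ∑ i ∈ A, lp.single 2 i (u i)) := by
    rw [inner_sub_right, inner_sum]
    congr 1
    refine Finset.sum_congr rfl fun i _ ↦ ?_
    rw [lp.inner_single_right]
    simp [mul_comm]
  have hnorm := lp.norm_compl_sum_single (p := 2) (by norm_num) u A
  simp only [ENNReal.toReal_ofNat, Real.rpow_ofNat, Real.norm_eq_abs, sq_abs] at hnorm
  rw [hinner]
  refine (abs_real_inner_le_norm _ _).trans (mul_le_mul_of_nonneg_left ?_ (norm_nonneg _))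
  exact (sq_le_sq₀ (norm_nonneg _) hτ).1 (hnorm.trans_le hA)

theorem lp.sum_sq_le_norm_sq {I : Type*} (w : lp (fun _ : I ↦ ℝ) 2) (A : Finset I) :
    ∑ i ∈ A, w i ^ 2 ≤ ‖w‖ ^ 2 := by
  have h := lp.sum_rpow_le_norm_rpow (p := 2) (by norm_num) w A
  simpa using h

theorem gaussianEmbedding_apply {d : ℕ} (X : Set (EuclideanSpace ℝ (Fin d))) (σ : ℝ)
    (f : GaussianRKHS X σ) (x : X) : gaussianEmbedding X σ f x = f x := rfl

/-- A feature map into `ℓ²` whose coordinates outside the finite set `A` have norm at most `τ`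
yields a covering by balls of radius `τ + δ`, with centres that depend on the coordinates in `A`
only. -/
theorem logCoveringNumber_gaussianEmbedding_le {d : ℕ} {X : Set (EuclideanSpace ℝ (Fin d))}
    {σ : ℝ} {I : Type*} (φ : X → lp (fun _ : I ↦ ℝ) 2)
    (hφ : ∀ x y : X, inner ℝ (φ x) (φ y) = gaussianKernel σ (x : EuclideanSpace ℝ (Fin d)) y)
    (A : Finset I) {τ δ : ℝ} (hτ : 0 ≤ τ) (hδ : 0 < δ)
    (hA : ∀ x, 1 - ∑ i ∈ A, φ x i ^ 2 ≤ τ ^ 2) :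
    logCoveringNumber (τ + δ) (gaussianEmbedding X σ) ≤
      ((A.card * Real.log (1 + 2 / δ) : ℝ) : EReal) := by
  classical
  have hnorm (x : X) : ‖φ x‖ ^ 2 = 1 := by
    rw [← real_inner_self_eq_norm_sq, hφ]
    simp [gaussianKernel]
  have hker (x y : X) : RKHS.kernel (GaussianRKHS X σ) x y 1 = inner ℝ (φ x) (φ y) := by
    rw [RKHS.OfKernel.kernel_ofKernel, hφ]
    simp [gaussianKernelMatrix]
  obtain ⟨s, hcard, hs1, hcov⟩ := exists_finset_cover_unit_ball (E := EuclideanSpace ℝ A) hδ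
  rw [finrank_euclideanSpace, Fintype.card_coe] at hcard
  have hCS (v : EuclideanSpace ℝ A) (x : X) : |∑ i, v i * φ x i| ≤ ‖v‖ := by
    refine abs_le_of_sq_le_sq ?_ (norm_nonneg v)
    calc (∑ i, v i * φ x i) ^ 2 ≤ (∑ i, v i ^ 2) * ∑ i : A, φ x i ^ 2 :=
          Finset.sum_mul_sq_le_sq_mul_sq _ _ _
      _ ≤ ‖v‖ ^ 2 * 1 := by
        rw [EuclideanSpace.real_norm_sq_eq]
        refine mul_le_mul_of_nonneg_left ?_ (by positivity)
        rw [Finset.sum_coe_sort A fun i ↦ φ x i ^ 2, ← hnorm x]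
        exact lp.sum_sq_le_norm_sq _ _
      _ = _ := mul_one _
  let g : EuclideanSpace ℝ A → lp (fun _ : X ↦ ℝ) ∞ := fun v ↦
    ⟨fun x ↦ ∑ i, v i * φ x i, memℓp_infty ⟨‖v‖, by
      rintro _ ⟨x, rfl⟩
      exact hCS v x⟩⟩
  have hg (v : EuclideanSpace ℝ A) (x : X) : g v x = ∑ i, v i * φ x i := rfl
  set T := gaussianEmbedding X σ
  set U := ⋃ c ∈ s, Metric.closedBall (g c) (τ + δ)
  -- Closedness of `U` reduces the covering to the kernel span, where feature vectors are available.
  -- The open ball is used because a dense set meets it densely.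
  have hU : IsClosed U := s.finite_toSet.isClosed_biUnion fun c _ ↦ Metric.isClosed_closedBall
  set S := Submodule.span ℝ {RKHS.kerFun (GaussianRKHS X σ) x v | (x) (v)}
  have hS : Dense (S : Set (GaussianRKHS X σ)) :=
    Submodule.dense_iff_topologicalClosure_eq_top.2 (RKHS.kerFun_dense _)
  have hspan : Metric.ball 0 1 ∩ (S : Set (GaussianRKHS X σ)) ⊆ T ⁻¹' U := by
    rintro f ⟨hf1, hfS⟩
    obtain ⟨w, hwf, hw⟩ := RKHS.exists_feature_of_mem_span hker hfS
    have hf1' : ‖f‖ ≤ 1 := (mem_ball_zero_iff.1 hf1).le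
    let v : EuclideanSpace ℝ A := WithLp.toLp 2 fun i ↦ w i
    have hv : ‖v‖ ≤ 1 := by
      rw [← abs_norm, ← sq_le_one_iff_abs_le_one, EuclideanSpace.real_norm_sq_eq]
      calc ∑ i : A, w i ^ 2 = ∑ i ∈ A, w i ^ 2 := Finset.sum_coe_sort A fun i ↦ w i ^ 2
        _ ≤ ‖w‖ ^ 2 := lp.sum_sq_le_norm_sq _ _
        _ ≤ 1 := by rw [hwf]; exact pow_le_one₀ (norm_nonneg _) hf1'
    obtain ⟨c, hc, hvc⟩ := hcov v hv
    refine Set.mem_preimage.2 (Set.mem_iUnion₂.2 ⟨c, hc, ?_⟩)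
    rw [Metric.mem_closedBall, dist_eq_norm]
    refine lp.norm_le_of_forall_le (by positivity) fun x ↦ ?_
    rw [lp.coeFn_sub, Pi.sub_apply, gaussianEmbedding_apply, hg, hw x, Real.norm_eq_abs]
    have h1 := lp.abs_inner_sub_sum_le w (φ x) A hτ (by rw [hnorm x]; exact hA x)
    have h2 := hCS (v - c) x
    rw [← dist_eq_norm] at h2
    have h3 : ∑ i, (v - c) i * φ x i = ∑ i ∈ A, w i * φ x i - ∑ i, c i * φ x i := by
      rw [← Finset.sum_coe_sort A fun i ↦ w i * φ x i, ← Finset.sum_sub_distrib]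
      exact Finset.sum_congr rfl fun i _ ↦ by simp [v, sub_mul]
    have h4 : ‖w‖ * τ ≤ τ := mul_le_of_le_one_left hτ (hwf.trans_le hf1')
    rw [h3] at h2
    calc _ = |(inner ℝ w (φ x) - ∑ i ∈ A, w i * φ x i) +
          (∑ i ∈ A, w i * φ x i - ∑ i, c i * φ x i)| := by congr 1; ring
      _ ≤ _ := abs_add_le _ _
      _ ≤ _ := add_le_add (h1.trans h4) (h2.trans hvc)
  have hball : Metric.closedBall (0 : GaussianRKHS X σ) 1 ⊆ T ⁻¹' U := by
    rw [← closure_ball (0 : GaussianRKHS X σ) one_ne_zero]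
    refine closure_minimal ?_ (hU.preimage T.continuous)
    exact (hS.open_subset_closure_inter Metric.isOpen_ball).trans
      (closure_minimal hspan (hU.preimage T.continuous))
  have hcover : Metric.IsCover (τ + δ).toNNReal (T '' Metric.closedBall 0 1)
      ((s.image g : Finset _) : Set (lp (fun _ : X ↦ ℝ) ∞)) := by
    rw [Metric.isCover_iff_subset_iUnion_closedBall, Real.coe_toNNReal _ (by positivity)]
    refine (Set.image_subset_iff.2 hball).trans ?_
    simp [U]
  have hnum := hcover.externalCoveringNumber_le_encard
  rw [Set.encard_coe_eq_coe_finsetCard] at hnum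
  have hnum' : ((Metric.externalCoveringNumber (τ + δ).toNNReal
      (T '' Metric.closedBall 0 1) : ℕ∞) : ℝ≥0∞) ≤ ENNReal.ofReal ((1 + 2 / δ) ^ A.card) := by
    refine (ENat.toENNReal_le.2 hnum).trans ?_
    rw [ENat.toENNReal_coe, ← ENNReal.ofReal_natCast]
    exact ENNReal.ofReal_le_ofReal (le_trans (by exact_mod_cast Finset.card_image_le) hcard)
  refine (ENNReal.log_monotone hnum').trans_eq ?_
  rw [ENNReal.log_ofReal_of_pos (by positivity), Real.log_pow]

/-! ### The Taylor feature map of the Gaussian kernel -/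

/-- Multi-indices in `d` variables, sorted by degree. -/
abbrev GradedMultiIndex (d : ℕ) : Type :=
  Σ n : ℕ, {k : Fin d → ℕ // k ∈ Finset.piAntidiag Finset.univ n}

/-- The coordinates of the Taylor feature map of the Gaussian kernel. -/
noncomputable def gaussianFeature {d : ℕ} (σ : ℝ) (x : EuclideanSpace ℝ (Fin d))
    (i : GradedMultiIndex d) : ℝ :=
  Real.exp (-σ ^ 2 * ‖x‖ ^ 2) *
    √((2 * σ ^ 2) ^ i.1 * Nat.multinomial Finset.univ i.2.1 / i.1.factorial) *
    ∏ j, x j ^ i.2.1 j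

/-- The multinomial theorem for `⟨x, y⟩ ^ n`; the square-root weights are chosen to produce its
coefficients over `n!`. -/
theorem sum_gaussianFeature_mul {d : ℕ} (σ : ℝ) (x y : EuclideanSpace ℝ (Fin d)) (n : ℕ) :
    ∑ k : {k : Fin d → ℕ // k ∈ Finset.piAntidiag Finset.univ n},
      gaussianFeature σ x ⟨n, k⟩ * gaussianFeature σ y ⟨n, k⟩ =
    Real.exp (-σ ^ 2 * ‖x‖ ^ 2) * Real.exp (-σ ^ 2 * ‖y‖ ^ 2) *
      ((2 * σ ^ 2 * inner ℝ x y) ^ n / n.factorial) := by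
  have hinner : inner ℝ x y = ∑ j, x j * y j := by
    rw [PiLp.inner_apply]
    simp [mul_comm]
  rw [hinner, mul_pow, Finset.sum_pow_eq_sum_piAntidiag, mul_div_assoc, ← mul_assoc,
    Finset.sum_div, Finset.mul_sum, ← Finset.sum_coe_sort (Finset.piAntidiag Finset.univ n)]
  refine Finset.sum_congr rfl fun k _ ↦ ?_
  have hsqrt : √((2 * σ ^ 2) ^ n * Nat.multinomial Finset.univ k.1 / n.factorial) *
      √((2 * σ ^ 2) ^ n * Nat.multinomial Finset.univ k.1 / n.factorial) =
      (2 * σ ^ 2) ^ n * Nat.multinomial Finset.univ k.1 / n.factorial :=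
    Real.mul_self_sqrt (by positivity)
  simp only [gaussianFeature, mul_pow (x _), Finset.prod_mul_distrib]
  calc _ = Real.exp (-σ ^ 2 * ‖x‖ ^ 2) * Real.exp (-σ ^ 2 * ‖y‖ ^ 2) *
        (√((2 * σ ^ 2) ^ n * Nat.multinomial Finset.univ k.1 / n.factorial) *
          √((2 * σ ^ 2) ^ n * Nat.multinomial Finset.univ k.1 / n.factorial)) *
        ((∏ j, x j ^ k.1 j) * ∏ j, y j ^ k.1 j) := by ring
    _ = _ := by rw [hsqrt]; ring

theorem sum_gaussianFeature_sq {d : ℕ} (σ : ℝ) (x : EuclideanSpace ℝ (Fin d)) (n : ℕ) :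
    ∑ k : {k : Fin d → ℕ // k ∈ Finset.piAntidiag Finset.univ n},
      gaussianFeature σ x ⟨n, k⟩ ^ 2 =
    Real.exp (-(2 * σ ^ 2 * ‖x‖ ^ 2)) * ((2 * σ ^ 2 * ‖x‖ ^ 2) ^ n / n.factorial) := by
  simp only [sq (gaussianFeature _ _ _)]
  rw [sum_gaussianFeature_mul, real_inner_self_eq_norm_sq, ← Real.exp_add]
  congr 2
  ring

theorem summable_gaussianFeature_sq {d : ℕ} (σ : ℝ) (x : EuclideanSpace ℝ (Fin d)) :
    Summable fun i ↦ gaussianFeature σ x i ^ 2 := by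
  rw [summable_sigma_of_nonneg fun _ ↦ sq_nonneg _]
  refine ⟨fun n ↦ Summable.of_finite, ?_⟩
  simp only [tsum_fintype, sum_gaussianFeature_sq]
  exact (hasSum_real_exp _).summable.mul_left _

/-- The Taylor feature map of the Gaussian kernel, with values in `ℓ²`. -/
noncomputable def gaussianFeatureMap {d : ℕ} (σ : ℝ) (x : EuclideanSpace ℝ (Fin d)) :
    lp (fun _ : GradedMultiIndex d ↦ ℝ) 2 :=
  ⟨gaussianFeature σ x, memℓp_gen (by simpa using summable_gaussianFeature_sq σ x)⟩

theorem gaussianFeatureMap_apply {d : ℕ} (σ : ℝ) (x : EuclideanSpace ℝ (Fin d))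
    (i : GradedMultiIndex d) : gaussianFeatureMap σ x i = gaussianFeature σ x i := rfl

theorem inner_gaussianFeatureMap {d : ℕ} (σ : ℝ) (x y : EuclideanSpace ℝ (Fin d)) :
    inner ℝ (gaussianFeatureMap σ x) (gaussianFeatureMap σ y) = gaussianKernel σ x y := by
  have h : HasSum (fun i ↦ gaussianFeature σ x i * gaussianFeature σ y i)
      (inner ℝ (gaussianFeatureMap σ x) (gaussianFeatureMap σ y)) := by
    simpa [gaussianFeatureMap_apply, mul_comm] using
      lp.hasSum_inner (𝕜 := ℝ) (gaussianFeatureMap σ x) (gaussianFeatureMap σ y)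
  have h' := h.sigma fun n ↦ hasSum_fintype _
  simp only [sum_gaussianFeature_mul] at h'
  refine (h'.unique ((hasSum_real_exp _).mul_left _)).trans ?_
  rw [← Real.exp_add, ← Real.exp_add, gaussianKernel, norm_sub_sq_real]
  congr 1
  ring

theorem card_piAntidiag_univ_fin (d n : ℕ) :
    (Finset.piAntidiag (Finset.univ : Finset (Fin d)) n).card = (d + n - 1).choose n := by
  have h := Finset.card_finsuppAntidiag_nat_eq_choose (s := (Finset.univ : Finset (Fin d))) n
  rw [Finset.finsuppAntidiag, Finset.card_map, Finset.card_attach] at h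
  simpa using h

theorem sum_range_card_piAntidiag {d : ℕ} (hd : 1 ≤ d) (M : ℕ) :
    ∑ n ∈ Finset.range (M + 1), (Finset.piAntidiag (Finset.univ : Finset (Fin d)) n).card =
      (M + d).choose d := by
  obtain ⟨e, rfl⟩ : ∃ e, d = e + 1 := ⟨d - 1, by omega⟩
  -- With the lower index `M`, the induction step is exactly Pascal's rule.
  rw [← Nat.choose_symm_add]
  induction M with
  | zero => simp
  | succ M ih =>
    rw [Finset.sum_range_succ, ih, card_piAntidiag_univ_fin,
      show e + 1 + (M + 1) - 1 = M + (e + 1) by omega,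
      show M + 1 + (e + 1) = M + (e + 1) + 1 by omega, Nat.choose_succ_succ]

/-- The multi-indices of degree at most `M`. -/
def lowDegree (d M : ℕ) : Finset (GradedMultiIndex d) :=
  (Finset.range (M + 1)).sigma fun _ ↦ Finset.univ

theorem card_lowDegree {d : ℕ} (hd : 1 ≤ d) (M : ℕ) :
    (lowDegree d M).card = (M + d).choose d := by
  rw [lowDegree, Finset.card_sigma, ← sum_range_card_piAntidiag hd]
  simp

theorem one_sub_sum_lowDegree_le {d : ℕ} {σ : ℝ} {x : EuclideanSpace ℝ (Fin d)} (hx : ‖x‖ ≤ 1)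
    {M : ℕ} (hM : 2 * σ ^ 2 ≤ (M + 1 : ℕ)) :
    1 - ∑ i ∈ lowDegree d M, gaussianFeatureMap σ x i ^ 2 ≤
      (Real.exp 1 * (2 * σ ^ 2) / (M + 1 : ℕ)) ^ (M + 1) := by
  simp only [lowDegree, Finset.sum_sigma, gaussianFeatureMap_apply, sum_gaussianFeature_sq]
  exact one_sub_sum_exp_neg_mul_le (by positivity)
    (mul_le_of_le_one_right (by positivity) (pow_le_one₀ (norm_nonneg _) hx)) (by omega) hM

/-! ### Choice of the degree and final estimate -/

theorem polyT₀_mul_rpow {d : ℕ} {σ p ε w : ℝ} (hp : 0 < p) (hε : 0 < ε)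
    (hw : w = lambertW₀ (((d : ℝ) + 1) / (p * σ ^ 2))) (hw0 : 0 < w) :
    polyT₀ d σ p * ε ^ (-(p / ((d : ℝ) + 1))) =
      2 * (Real.exp (p / ((d : ℝ) + 1) * Real.log (4 / ε) + 1 / w) /
        (Real.exp 1 * (p / ((d : ℝ) + 1)) * w)) := by
  have hexp : Real.exp (p / ((d : ℝ) + 1) * Real.log (4 / ε) + 1 / w) =
      (4 : ℝ) ^ (p / ((d : ℝ) + 1)) * ε ^ (-(p / ((d : ℝ) + 1))) * Real.exp (1 / w) := by
    rw [Real.exp_add, mul_comm (p / ((d : ℝ) + 1)), ← Real.rpow_def_of_pos (by positivity),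
      Real.div_rpow (by norm_num) hε.le, Real.rpow_neg hε.le, div_eq_mul_inv]
  rw [hexp, polyT₀, ← hw]
  field_simp

/-- Truncating the Taylor feature map at degree `M` with error at most `ε / 4` bounds the covering
numbers by those of a space of dimension `(M + d).choose d`. -/
theorem logCoveringNumber_le_choose_mul_log {d : ℕ} (hd : 1 ≤ d) {σ ε : ℝ} (hε : 0 < ε)
    (hε1 : ε ≤ 1) {M : ℕ} (hlam : 2 * σ ^ 2 ≤ (M + 1 : ℕ))
    (herr : (Real.exp 1 * (2 * σ ^ 2) / (M + 1 : ℕ)) ^ (M + 1) ≤ (ε / 4) ^ 2) :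
    logCoveringNumber ε
        (gaussianEmbedding (Metric.closedBall (0 : EuclideanSpace ℝ (Fin d)) 1) σ) ≤
      (((M + d).choose d * Real.log (4 / ε) : ℝ) : EReal) := by
  set X := Metric.closedBall (0 : EuclideanSpace ℝ (Fin d)) 1
  have hA (x : X) : 1 - ∑ i ∈ lowDegree d M, gaussianFeatureMap σ x.1 i ^ 2 ≤ (ε / 4) ^ 2 :=
    (one_sub_sum_lowDegree_le (mem_closedBall_zero_iff.1 x.2) hlam).trans herr
  -- The radius splits as `ε / 4` for truncation and `3ε / 4` for the net, so that `1 + 8 / (3ε) ≤ 4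
  -- / ε` for `ε ≤ 4 / 3`.
  have hτ : 0 ≤ ε / 4 := by positivity
  have hδ : 0 < 3 * ε / 4 := by positivity
  have hcov := logCoveringNumber_gaussianEmbedding_le
    (fun x : X ↦ gaussianFeatureMap σ x.1)
    (fun x y ↦ inner_gaussianFeatureMap σ x.1 y.1) (lowDegree d M) hτ hδ hA
  rw [show ε / 4 + 3 * ε / 4 = ε by ring, card_lowDegree hd] at hcov
  refine hcov.trans (EReal.coe_le_coe_iff.2 (mul_le_mul_of_nonneg_left ?_ (Nat.cast_nonneg _)))
  refine Real.log_le_log (by positivity) ?_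
  rw [← sub_nonneg]
  have : 4 / ε - (1 + 2 / (3 * ε / 4)) = (4 / 3 - ε) / ε := by
    field_simp
    ring
  rw [this]
  exact div_nonneg (by linarith) hε.le

/-- The truncation error at degree `⌊2 S⌋` when `S log (S / (e σ²)) ≥ log (4 / ε)`. -/
theorem truncation_error_le {σ ε S : ℝ} (hσ : 0 < σ) (hε : 0 < ε) (hS : 0 < S)
    (hlog : 0 ≤ Real.log (S / (Real.exp 1 * σ ^ 2)))
    (hkey : Real.log (4 / ε) ≤ S * Real.log (S / (Real.exp 1 * σ ^ 2))) {M : ℕ}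
    (hM : 2 * S ≤ (M + 1 : ℕ)) :
    2 * σ ^ 2 ≤ (M + 1 : ℕ) ∧
      (Real.exp 1 * (2 * σ ^ 2) / (M + 1 : ℕ)) ^ (M + 1) ≤ (ε / 4) ^ 2 := by
  have hratio : 2 * S / (Real.exp 1 * (2 * σ ^ 2)) = S / (Real.exp 1 * σ ^ 2) := by
    field_simp
  constructor
  · refine le_trans ?_ hM
    have h1 : 1 ≤ S / (Real.exp 1 * σ ^ 2) := by
      rwa [Real.log_nonneg_iff (by positivity)] at hlog
    rw [one_le_div (by positivity)] at h1
    nlinarith [Real.add_one_le_exp (1 : ℝ), pow_pos hσ 2]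
  -- The factor `2` in `c` is needed because the tail bounds a squared norm; it is matched by the
  -- threshold `2 * S` and the rate `2 * σ ^ 2`.
  · refine (pow_le_exp_neg_of_le_mul_log (c := 2 * Real.log (4 / ε)) (by positivity)
      (by positivity) hM (by rwa [hratio]) (by rw [hratio]; linarith)).trans_eq ?_
    rw [neg_mul_eq_mul_neg, ← Real.log_inv, inv_div, mul_comm, Real.exp_mul,
      Real.exp_log (by positivity)]
    norm_num

theorem theorem3 (d : ℕ) (hd : 1 ≤ d) (σ : ℝ) (hσ : 0 < σ) (p : ℝ) (hp : 0 < p)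
    (ε : ℝ) (hε : 0 < ε) (hε1 : ε ≤ 1) :
    logCoveringNumber ε
        (gaussianEmbedding (Metric.closedBall (0 : EuclideanSpace ℝ (Fin d)) 1) σ) ≤
      ((genBinom (polyT₀ d σ p + (d : ℝ)) d * (((d : ℝ) + 1) / (Real.exp 1 * p)) *
        (4 : ℝ) ^ (p / ((d : ℝ) + 1)) * ε ^ (-p) : ℝ) : EReal) := by
  obtain ⟨w, hw⟩ : ∃ w, w = lambertW₀ (((d : ℝ) + 1) / (p * σ ^ 2)) := ⟨_, rfl⟩
  have hw0 : 0 < w := hw ▸ lambertW₀_pos (by positivity)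
  obtain ⟨q, hq⟩ : ∃ q, q = p / ((d : ℝ) + 1) := ⟨_, rfl⟩
  have hq0 : 0 < q := by rw [hq]; positivity
  have hwexp : w * Real.exp w = 1 / (q * σ ^ 2) := by
    rw [hw, hq, lambertW₀_mul_exp (by positivity)]
    field_simp
  have hT := polyT₀_mul_rpow hp hε hw hw0
  rw [← hq] at hT
  have hL0 : 0 ≤ Real.log (4 / ε) := Real.log_nonneg ((one_le_div hε).2 (by linarith))
  obtain ⟨r, hr⟩ : ∃ r, r = ε ^ (-q) := ⟨_, rfl⟩
  have hr1 : 1 ≤ r := hr ▸ Real.one_le_rpow_of_pos_of_le_one_of_nonpos hε hε1 (by linarith)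
  have ht0 : 0 < polyT₀ d σ p := by
    rw [polyT₀, ← hw]
    positivity
  obtain ⟨hlog, hkey⟩ := le_mul_log_of_mul_exp_eq hq0 (pow_pos hσ 2) hw0 hwexp hL0
  obtain ⟨S, hS⟩ : ∃ S, S = Real.exp (q * Real.log (4 / ε) + 1 / w) / (Real.exp 1 * q * w) :=
    ⟨_, rfl⟩
  rw [← hS] at hlog hkey hT
  have hS0 : 0 < S := by rw [hS]; positivity
  -- The floor serves both sides: `M + 1 ≥ 2S` for the tail, `M ≤ 2S = t₀ r` for the dimension.
  obtain ⟨hlam, herr⟩ := truncation_error_le (M := ⌊2 * S⌋₊) hσ hε hS0 hlog hkey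
    (by push_cast; exact (Nat.lt_floor_add_one _).le)
  refine (logCoveringNumber_le_choose_mul_log hd hε hε1 hlam herr).trans
    (EReal.coe_le_coe_iff.2 ?_)
  have hcard : ((⌊2 * S⌋₊ + d).choose d : ℝ) ≤ r ^ d * genBinom (polyT₀ d σ p + d) d := by
    refine (choose_le_genBinom (t := polyT₀ d σ p * r) ?_).trans (genBinom_mul_le ht0.le hr1 d)
    rw [hr, hT]
    exact Nat.floor_le (by positivity)
  have hLle : Real.log (4 / ε) ≤ (4 : ℝ) ^ q * r / (Real.exp 1 * q) := by
    refine (log_le_rpow_div_exp_one_mul (by positivity) hq0).trans_eq ?_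
    rw [Real.div_rpow (by norm_num) hε.le, hr, Real.rpow_neg hε.le, div_eq_mul_inv (_ ^ q)]
  have hrpow : r ^ d * r = ε ^ (-p) := by
    rw [← pow_succ, hr, ← Real.rpow_natCast, ← Real.rpow_mul hε.le, hq]
    congr 1
    push_cast
    field_simp
  refine (mul_le_mul hcard hLle hL0
    (mul_nonneg (by positivity) (genBinom_add_nonneg ht0.le d))).trans_eq ?_
  have hqinv : ((d : ℝ) + 1) / (Real.exp 1 * p) = 1 / (Real.exp 1 * q) := by
    rw [hq]
    field_simp
  rw [← hrpow, hqinv, ← hq]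
  ring
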